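/- Let $n>2$. For $i,j\in\mathbb Z/n\mathbb Z$ with $i\neq j$, let $[i,j]_c$ be the circular interval $\{i,i+1,\dots,j\}\subseteq\mathbb Z/n\mathbb Z$, listed in this order, and let $s_{i,j}$ be the permutation of $\mathbb Z/n\mathbb Z$ that reverses $[i,j]_c$, that is, $s_{i,j}(p)=i+j-p$ for $p\in[i,j]_c$ and $s_{i,j}(p)=p$ otherwise. Write $[i,j]_c\subset_c[k,l]_c$ if every element of $[i,j]_c$ belongs to $[k,l]_c$ and the elements of $[i,j]_c$ occur in $[k,l]_c$ in the same order. The affine cactus group $AJ_n$ is the group with generators $\sigma_{i,j}$ ($i,j\in\mathbb Z/n\mathbb Z$, $i\ne j$) and relations $$\sigma_{i,j}^2=1;\qquad \sigma_{i,j}\sigma_{k,l}=\sigma_{k,l}\sigma_{i,j}\ \text{ if } [i,j]_c\cap[k,l]_c=\emptyset;\qquad \sigma_{i,j}\sigma_{k,l}=\sigma_{k,l}\,\sigma_{s_{k,l}(j),\,s_{k,l}(i)}\ \text{ if } [i,j]_c\subset_c[k,l]_c .$$ Let $\pi\colon AJ_n\to S_n$ be the homomorphism to the group $S_n$ of permutations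 of $\mathbb Z/n\mathbb Z$ with $\pi(\sigma_{i,j})=s_{i,j}$. Then the pure affine cactus group $PAJ_n=\ker\pi$ is residually nilpotent: for every $g\in PAJ_n$ with $g\neq1$ there is a normal subgroup $N$ of $PAJ_n$ such that $g\notin N$ and $PAJ_n/N$ is nilpotent. -/

import Mathlib

/-- The circular interval `[i, j]_c = {i < i + 1 < ⋯ < j}` of `ℤ/nℤ`, as a set. The rank of `p` in
it, for the circular order that starts at `i`, is `(p - i).val`. -/
def circInterval (n : ℕ) (i j : ZMod n) : Set (ZMod n) :=
  {p | (p - i).val ≤ (j - i).val}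

/-- `[i, j]_c ⊂_c [k, l]_c`: the elements of `[i, j]_c` belong to `[k, l]_c`, and
they occur there in the same order as in `[i, j]_c`. -/
def CircSubset (n : ℕ) (i j k l : ZMod n) : Prop :=
  circInterval n i j ⊆ circInterval n k l ∧
    ∀ p ∈ circInterval n i j, ∀ q ∈ circInterval n i j,
      (p - i).val < (q - i).val → (p - k).val < (q - k).val

theorem circInterval_reflect {n : ℕ} [NeZero n] (i j p : ZMod n) :
    i + j - p ∈ circInterval n i j ↔ p ∈ circInterval n i j := by
  have key : ∀ a b : ZMod n, a.val ≤ b.val → (b - a).val ≤ b.val := by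
    intro a b h
    rw [ZMod.val_sub h]
    exact Nat.sub_le _ _
  have e1 : i + j - p - i = (j - i) - (p - i) := by ring
  constructor
  · intro h
    have h1 := key _ _ (show (i + j - p - i).val ≤ (j - i).val from h)
    have e2 : j - i - (i + j - p - i) = p - i := by ring
    rw [e2] at h1
    exact h1
  · intro h
    change (i + j - p - i).val ≤ (j - i).val
    rw [e1]
    exact key _ _ h

open Classical in
/-- The underlying map of `s_{i,j}`: it reverses `[i, j]_c` and fixes all other points. -/
noncomputable def circReverseFun (n : ℕ) (i j p : ZMod n) : ZMod n :=
  if p ∈ circInterval n i j then i + j - p else p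

theorem circReverseFun_involutive (n : ℕ) [NeZero n] (i j : ZMod n) :
    Function.Involutive (circReverseFun n i j) := by
  intro p
  by_cases h : p ∈ circInterval n i j
  · have h' := (circInterval_reflect i j p).2 h
    simp only [circReverseFun, h, h', if_true]
    ring
  · simp only [circReverseFun, h, if_false]

/-- The permutation `s_{i,j}` of `ℤ/nℤ` that reverses the circular interval `[i, j]_c`. -/
noncomputable def circReverse (n : ℕ) [NeZero n] (i j : ZMod n) : Equiv.Perm (ZMod n) :=
  (circReverseFun_involutive n i j).toPerm

/-- The index set of the generators `σ_{i,j}`: ordered pairs of distinct elements of `ℤ/nℤ`. -/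
abbrev CactusIndex (n : ℕ) : Type := {x : ZMod n × ZMod n // x.1 ≠ x.2}

/-- The index `(s_{k,l}(j), s_{k,l}(i))`, for `x = (i, j)` and `y = (k, l)`. -/
noncomputable def cactusFlip (n : ℕ) [NeZero n] (x y : CactusIndex n) : CactusIndex n :=
  ⟨(circReverse n y.1.1 y.1.2 x.1.2, circReverse n y.1.1 y.1.2 x.1.1),
    fun h => x.2 ((circReverse n y.1.1 y.1.2).injective h).symm⟩

/-- The defining relators of the affine cactus group; a relation `u = v` is the relator
`u * v⁻¹`. -/
inductive AffineCactusRel (n : ℕ) [NeZero n] : FreeGroup (CactusIndex n) → Prop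
  | square (x : CactusIndex n) :
      AffineCactusRel n (FreeGroup.of x ^ 2)
  | disjoint (x y : CactusIndex n)
      (h : circInterval n x.1.1 x.1.2 ∩ circInterval n y.1.1 y.1.2 = ∅) :
      AffineCactusRel n
        ((FreeGroup.of x * FreeGroup.of y) * (FreeGroup.of y * FreeGroup.of x)⁻¹)
  | nested (x y : CactusIndex n) (h : CircSubset n x.1.1 x.1.2 y.1.1 y.1.2) :
      AffineCactusRel n
        ((FreeGroup.of x * FreeGroup.of y) * (FreeGroup.of y * FreeGroup.of (cactusFlip n x y))⁻¹)

/-- The affine cactus group `AJ_n`. -/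
abbrev AffineCactusGroup (n : ℕ) [NeZero n] : Type :=
  PresentedGroup {r : FreeGroup (CactusIndex n) | AffineCactusRel n r}

theorem circReverse_rel (n : ℕ) [NeZero n] (r : FreeGroup (CactusIndex n))
    (hr : r ∈ {r : FreeGroup (CactusIndex n) | AffineCactusRel n r}) :
    FreeGroup.lift (fun x : CactusIndex n => circReverse n x.1.1 x.1.2) r = 1 := by
  have hin : ∀ i j p : ZMod n, p ∈ circInterval n i j → circReverse n i j p = i + j - p :=
    fun i j p h => if_pos h
  have hout : ∀ i j p : ZMod n, p ∉ circInterval n i j → circReverse n i j p = p :=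
    fun i j p h => if_neg h
  cases hr with
  | square x =>
    rw [map_pow, FreeGroup.lift_apply_of, pow_two]
    exact Equiv.ext (circReverseFun_involutive n _ _)
  | disjoint x y h =>
    obtain ⟨⟨i, j⟩, hx⟩ := x
    obtain ⟨⟨k, l⟩, hy⟩ := y
    simp only at h
    rw [map_mul, map_inv, mul_inv_eq_one]
    simp only [map_mul, FreeGroup.lift_apply_of]
    have hd : ∀ p, p ∈ circInterval n i j → p ∉ circInterval n k l := fun p h1 h2 => by
      have h3 : p ∈ circInterval n i j ∩ circInterval n k l := ⟨h1, h2⟩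
      rw [h] at h3
      exact h3
    ext1 p
    rw [Equiv.Perm.mul_apply, Equiv.Perm.mul_apply]
    by_cases h1 : p ∈ circInterval n i j
    · rw [hout k l p (hd p h1), hin i j p h1,
        hout k l _ (hd _ ((circInterval_reflect i j p).2 h1))]
    · rw [hout i j p h1]
      by_cases h2 : p ∈ circInterval n k l
      · rw [hin k l p h2,
          hout i j _ (fun h3 => hd _ h3 ((circInterval_reflect k l p).2 h2))]
      · rw [hout k l p h2, hout i j p h1]
  | nested x y h =>
    obtain ⟨⟨i, j⟩, hx⟩ := x
    obtain ⟨⟨k, l⟩, hy⟩ := y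
    have hs : circInterval n i j ⊆ circInterval n k l := h.1
    have hi : i ∈ circInterval n i j := by simp [circInterval]
    have hj : j ∈ circInterval n i j := by simp [circInterval]
    rw [map_mul, map_inv, mul_inv_eq_one]
    simp only [map_mul, FreeGroup.lift_apply_of, cactusFlip]
    rw [hin k l i (hs hi), hin k l j (hs hj)]
    have hm : ∀ p, p ∈ circInterval n (k + l - j) (k + l - i) ↔
        k + l - p ∈ circInterval n i j := by
      intro p
      rw [← circInterval_reflect i j (k + l - p)]
      simp only [circInterval, Set.mem_ofPred_eq]
      have e1 : p - (k + l - j) = i + j - (k + l - p) - i := by ring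
      have e2 : k + l - i - (k + l - j) = j - i := by ring
      rw [e1, e2]
    ext1 p
    rw [Equiv.Perm.mul_apply, Equiv.Perm.mul_apply]
    by_cases h2 : p ∈ circInterval n k l
    · rw [hin k l p h2]
      by_cases h1 : k + l - p ∈ circInterval n i j
      · have h3 := hs ((circInterval_reflect i j _).2 h1)
        rw [hin i j _ h1, hin _ _ p ((hm p).2 h1)]
        have e : k + l - j + (k + l - i) - p = k + l - (i + j - (k + l - p)) := by ring
        rw [e, hin k l _ ((circInterval_reflect k l _).2 h3)]
        ring
      · rw [hout i j _ h1, hout _ _ p (fun h3 => h1 ((hm p).1 h3)), hin k l p h2]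
    · rw [hout k l p h2, hout i j p (fun h3 => h2 (hs h3)),
        hout _ _ p (fun h3 => h2 ((circInterval_reflect k l p).1 (hs ((hm p).1 h3)))),
        hout k l p h2]

/-- The morphism `π : AJ_n → S_n`, `σ_{i,j} ↦ s_{i,j}`. -/
noncomputable def affineCactusToPerm (n : ℕ) [NeZero n] :
    AffineCactusGroup n →* Equiv.Perm (ZMod n) :=
  PresentedGroup.toGroup (f := fun x : CactusIndex n => circReverse n x.1.1 x.1.2)
    (circReverse_rel n)

/-- The pure affine cactus group `PAJ_n = ker π`. -/
noncomputable def pureAffineCactusGroup (n : ℕ) [NeZero n] : Subgroup (AffineCactusGroup n) :=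
  (affineCactusToPerm n).ker

/-- A group is residually nilpotent if every nontrivial element survives in some nilpotent
quotient. -/
def IsResiduallyNilpotent (G : Type*) [Group G] : Prop :=
  ∀ g : G, g ≠ 1 → ∃ (N : Subgroup G) (_ : N.Normal), g ∉ N ∧ Group.IsNilpotent (G ⧸ N)

/-!
The affine cactus group is made to act on finite sets in such a way that the pure subgroup acts
through a `2`-group and every nontrivial element is detected.

The permutation `s_{i,j}` lifts to the double cover `ℤ/2nℤ → ℤ/nℤ`, where it reverses both arcs
above `[i, j]_c` (`coverReverse`). Let the *block* of `σ_{i,j}` be the unordered pair of these arcs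
(`coverBlock`). On the cover, unlike on the circle itself, the intervals of full length with
different starting points have different blocks, and `[i, j]_c ⊂_c [k, l]_c` becomes plain
inclusion of blocks (`coverBlock_subset_iff`). Consider the right-angled Coxeter group with one
generator for each set, two of them commuting when the sets are nested or disjoint
(`compatGraph`). Sending `σ_x` to the pair of its block and its lifted permutation defines a
homomorphism from the affine cactus group to the semidirect product of this Coxeter group with the
permutations of the cover. It is injective, because every commutation of neighbouring blocks comes
from a defining relation of the cactus group (`exists_sigma_mul_sigma_eq`), so that a word of
minimal length spells a reduced word of blocks (`isReducedWord_blockWord`).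

Neither the Coxeter group nor the semidirect product is constructed. Instead, a reduced word `a` of
length `k` defines operators `T_c = 1 + N_c` on the `𝔽₂`-valued functions of sets of positions of
`a`, where, if the positions in the set that block `c` form a final segment of all such positions
and the first of them carries the letter `c`, `N_c` removes that position (`IsRemovable`); otherwise
`N_c` is zero. They satisfy the Coxeter relations, `N_c ^ 2 = 0` being a consequence of reducedness
(`removal_mul_self`), they are unipotent in characteristic two and hence have orders that are powers
of two, together with all their products (`RaisesBy.pow_eq_one`). A nonempty word `a` itself acts
nontrivially: its operators, applied in order, empty the full set of positions in exactly one way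
(`foldr_letterOp_univ`). Inducing up along the permutations of the cover gives an action of the
affine cactus group on a finite set (`blockAction`). A pure element preserves the two-element fibres
of the cover, so its square fixes the permutation component and acts unipotently on the other one.
Thus the pure group acts through a finite `2`-group (`blockAction_pow_eq_one`), which is nilpotent.
-/

open scoped Pointwise

/-! ### Removal operators of a word over a commutation graph -/

section Removal

variable {X : Type*} (G : SimpleGraph X) {k : ℕ} (a : Fin k → X)

/-- The position `i` of the word `a` carries the letter `c`, and among the positions whose letter
does not commute with `c` the set `J` contains exactly those from `i` on. Thus `i` is the first
position of `J` in the chain of positions that block `c`. Letters commute when they are adjacent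
in `G`; in particular `c` blocks itself. -/
def IsRemovable (c : X) (i : Fin k) (J : Finset (Fin k)) : Prop :=
  a i = c ∧ ∀ j, ¬ G.Adj (a j) c → (j ∈ J ↔ i ≤ j)

/-- A word over the vertices of a commutation graph is reduced if two equal letters are always
separated by a letter that does not commute with them. -/
def IsReducedWord : Prop :=
  ∀ i j, i < j → a i = a j → ∃ m, i < m ∧ m < j ∧ ¬ G.Adj (a m) (a i)

open Classical in
/-- The nilpotent operator on `𝔽₂`-valued functions of sets of positions that removes from the set
the removable position with letter `c`, and gives `0` if there is none. -/
noncomputable def removal (c : X) : Module.End (ZMod 2) (Finset (Fin k) → ZMod 2) where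
  toFun f J := ∑ i, if IsRemovable G a c i J then f (J.erase i) else 0
  map_add' f g := by
    ext J
    simp only [Pi.add_apply, ← Finset.sum_add_distrib]
    refine Finset.sum_congr rfl fun i _ => ?_
    split_ifs <;> simp
  map_smul' r f := by
    ext J
    simp only [Pi.smul_apply, smul_eq_mul, RingHom.id_apply, Finset.mul_sum]
    refine Finset.sum_congr rfl fun i _ => ?_
    split_ifs <;> simp

/-- The unipotent operator by which a letter acts. -/
noncomputable def letterOp (c : X) : Module.End (ZMod 2) (Finset (Fin k) → ZMod 2) :=
  1 + removal G a c

variable {G a}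

theorem IsRemovable.mem {c : X} {i : Fin k} {J : Finset (Fin k)} (h : IsRemovable G a c i J) :
    i ∈ J :=
  (h.2 i (by rw [h.1]; exact G.irrefl)).2 le_rfl

theorem IsRemovable.unique {c : X} {i j : Fin k} {J : Finset (Fin k)}
    (hi : IsRemovable G a c i J) (hj : IsRemovable G a c j J) : i = j :=
  le_antisymm ((hi.2 j (by rw [hj.1]; exact G.irrefl)).1 hj.mem)
    ((hj.2 i (by rw [hi.1]; exact G.irrefl)).1 hi.mem)

theorem removal_apply_of_isRemovable {c : X} {i : Fin k} {J : Finset (Fin k)}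
    (h : IsRemovable G a c i J) (f : Finset (Fin k) → ZMod 2) :
    removal G a c f J = f (J.erase i) := by
  classical
  change (∑ j, if IsRemovable G a c j J then f (J.erase j) else 0) = _
  rw [Finset.sum_eq_single i, if_pos h]
  · intro j _ hj
    rw [if_neg fun h' => hj (h'.unique h)]
  · simp

theorem isRemovable_erase_iff {b c : X} (hbc : G.Adj b c) {i j : Fin k} {J : Finset (Fin k)}
    (hi : a i = b) : IsRemovable G a c j (J.erase i) ↔ IsRemovable G a c j J := by
  refine and_congr_right fun _ => forall_congr' fun m => imp_congr_right fun hm => ?_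
  have : m ≠ i := by
    rintro rfl
    exact hm (hi ▸ hbc)
  simp [this]

theorem removal_comm {b c : X} (hbc : G.Adj b c) :
    removal G a b * removal G a c = removal G a c * removal G a b := by
  classical
  refine LinearMap.ext fun f => funext fun J => ?_
  change (∑ i, if IsRemovable G a b i J then
      (∑ j, if IsRemovable G a c j (J.erase i) then f ((J.erase i).erase j) else 0) else 0) =
    ∑ j, if IsRemovable G a c j J then
      (∑ i, if IsRemovable G a b i (J.erase j) then f ((J.erase j).erase i) else 0) else 0
  have key : ∀ i j, (if IsRemovable G a b i J then
        if IsRemovable G a c j (J.erase i) then f ((J.erase i).erase j) else 0 else 0) =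
      if IsRemovable G a c j J then
        if IsRemovable G a b i (J.erase j) then f ((J.erase j).erase i) else 0 else 0 := by
    intro i j
    by_cases hi : a i = b
    · by_cases hj : a j = c
      · rw [isRemovable_erase_iff hbc hi, isRemovable_erase_iff hbc.symm hj,
          Finset.erase_right_comm]
        split_ifs <;> rfl
      · simp [IsRemovable, hj]
    · simp [IsRemovable, hi]
  have e1 : ∀ i, (if IsRemovable G a b i J then
      (∑ j, if IsRemovable G a c j (J.erase i) then f ((J.erase i).erase j) else 0) else 0) =
      ∑ j, if IsRemovable G a b i J then
        if IsRemovable G a c j (J.erase i) then f ((J.erase i).erase j) else 0 else 0 := by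
    intro i
    split_ifs <;> simp
  have e2 : ∀ j, (if IsRemovable G a c j J then
      (∑ i, if IsRemovable G a b i (J.erase j) then f ((J.erase j).erase i) else 0) else 0) =
      ∑ i, if IsRemovable G a c j J then
        if IsRemovable G a b i (J.erase j) then f ((J.erase j).erase i) else 0 else 0 := by
    intro j
    split_ifs <;> simp
  simp only [e1, e2]
  rw [Finset.sum_comm]
  exact Finset.sum_congr rfl fun j _ => Finset.sum_congr rfl fun i _ => key i j

/-- This is the only place where reducedness enters: after the first `c` has been removed, the
second one is blocked by a letter between the two. -/
theorem removal_mul_self (ha : IsReducedWord G a) (c : X) :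
    removal G a c * removal G a c = 0 := by
  classical
  refine LinearMap.ext fun f => funext fun J => ?_
  change (∑ i, if IsRemovable G a c i J then
      (∑ j, if IsRemovable G a c j (J.erase i) then f ((J.erase i).erase j) else 0) else 0) = 0
  refine Finset.sum_eq_zero fun i _ => ?_
  split_ifs with hi
  · refine Finset.sum_eq_zero fun j _ => if_neg fun hj => ?_
    have hjm := Finset.mem_erase.1 hj.mem
    have hij : i ≤ j := (hi.2 j (by rw [hj.1]; exact G.irrefl)).1 hjm.2
    obtain ⟨m, him, hmj, hm⟩ := ha i j (lt_of_le_of_ne hij (Ne.symm hjm.1)) (hi.1.trans hj.1.symm)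
    rw [hi.1] at hm
    have h1 : m ∈ J.erase i := Finset.mem_erase.2 ⟨him.ne', (hi.2 m hm).2 him.le⟩
    exact absurd ((hj.2 m hm).1 h1) (not_le.2 hmj)
  · rfl

theorem add_self_eq_zero_fun (f : Finset (Fin k) → ZMod 2) : f + f = 0 := by
  ext J
  exact CharTwo.add_self_eq_zero (f J)

theorem letterOp_apply (c : X) (f : Finset (Fin k) → ZMod 2) :
    letterOp G a c f = f + removal G a c f := rfl

theorem letterOp_letterOp (ha : IsReducedWord G a) (c : X) (f : Finset (Fin k) → ZMod 2) :
    letterOp G a c (letterOp G a c f) = f := by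
  have h := LinearMap.congr_fun (removal_mul_self ha c) f
  rw [Module.End.mul_apply, LinearMap.zero_apply] at h
  simp only [letterOp_apply, map_add, h, add_zero, add_assoc, add_self_eq_zero_fun]

theorem letterOp_comm {b c : X} (hbc : G.Adj b c) (f : Finset (Fin k) → ZMod 2) :
    letterOp G a b (letterOp G a c f) = letterOp G a c (letterOp G a b f) := by
  have h := LinearMap.congr_fun (removal_comm (a := a) hbc) f
  rw [Module.End.mul_apply, Module.End.mul_apply] at h
  simp only [letterOp_apply, map_add, h]
  abel

/-! ### Unipotence -/

/-- `T` differs from the identity by an operator that raises the order of vanishing (with respect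
to the cardinality of the set of positions) by at least `r`. -/
def RaisesBy (r : ℕ) (T : Module.End (ZMod 2) (Finset (Fin k) → ZMod 2)) : Prop :=
  ∀ (s : ℕ) (f : Finset (Fin k) → ZMod 2), (∀ J, J.card < s → f J = 0) →
    ∀ J : Finset (Fin k), J.card < s + r → T f J = f J

theorem raisesBy_one (r : ℕ) :
    RaisesBy r (1 : Module.End (ZMod 2) (Finset (Fin k) → ZMod 2)) :=
  fun _ _ _ _ _ => rfl

theorem RaisesBy.mul {r : ℕ} {T U : Module.End (ZMod 2) (Finset (Fin k) → ZMod 2)}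
    (hT : RaisesBy r T) (hU : RaisesBy r U) : RaisesBy r (T * U) := by
  intro s f hf J hJ
  rw [Module.End.mul_apply, hT s (U f) _ J hJ, hU s f hf J hJ]
  intro J' hJ'
  rw [hU s f hf J' (by omega), hf J' hJ']

theorem raisesBy_letterOp (c : X) : RaisesBy 1 (letterOp G a c) := by
  classical
  intro s f hf J hJ
  change f J + (∑ i, if IsRemovable G a c i J then f (J.erase i) else 0) = f J
  rw [Finset.sum_eq_zero, add_zero]
  intro i _
  split_ifs with hi
  · have := Finset.card_erase_lt_of_mem hi.mem
    exact hf _ (by omega)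
  · rfl

/-- In characteristic two `T ^ 2 - 1 = (T - 1) ^ 2`. -/
theorem RaisesBy.sq {r : ℕ} {T : Module.End (ZMod 2) (Finset (Fin k) → ZMod 2)}
    (hT : RaisesBy r T) : RaisesBy (r + r) (T * T) := by
  intro s f hf J hJ
  have h1 : ∀ J : Finset (Fin k), J.card < s + r → (T f - f) J = 0 := fun J hJ => by
    rw [Pi.sub_apply, hT s f hf J hJ, sub_self]
  have h2 := hT (s + r) (T f - f) h1 J (by omega)
  rw [map_sub, Pi.sub_apply, Pi.sub_apply] at h2
  have h3 := CharTwo.add_self_eq_zero (T f J)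
  have h4 := CharTwo.add_self_eq_zero (f J)
  rw [Module.End.mul_apply]
  linear_combination h2 + h3 - h4

theorem RaisesBy.pow_two_pow {T : Module.End (ZMod 2) (Finset (Fin k) → ZMod 2)}
    (hT : RaisesBy 1 T) (m : ℕ) : RaisesBy (2 ^ m) (T ^ 2 ^ m) := by
  induction m with
  | zero => simpa using hT
  | succ m ih =>
    have := ih.sq
    rwa [← two_mul, ← pow_succ', ← pow_two, ← pow_mul, ← pow_succ] at this

theorem RaisesBy.pow_eq_one {T : Module.End (ZMod 2) (Finset (Fin k) → ZMod 2)}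
    (hT : RaisesBy 1 T) : T ^ 2 ^ (k + 1) = 1 := by
  refine LinearMap.ext fun f => funext fun J => ?_
  have h1 : J.card ≤ k := by simpa using Finset.card_le_univ J
  have h2 : k + 1 < 2 ^ (k + 1) := Nat.lt_two_pow_self
  exact hT.pow_two_pow (k + 1) 0 f (fun J hJ => absurd hJ (Nat.not_lt_zero _)) J (by omega)

/-! ### A word acts nontrivially through its own removal operators -/

theorem foldr_letterOp_apply_eq_zero (l : List X) {f : Finset (Fin k) → ZMod 2}
    (hf : ∀ J, 0 < J.card → f J = 0) (J : Finset (Fin k)) (hJ : l.length < J.card) :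
    l.foldr (fun c g => letterOp G a c g) f J = 0 := by
  classical
  induction l generalizing J with
  | nil => exact hf J hJ
  | cons c l ih =>
    rw [List.length_cons] at hJ
    rw [List.foldr_cons]
    set F := l.foldr (fun c g => letterOp G a c g) f
    change F J + (∑ i, if IsRemovable G a c i J then F (J.erase i) else 0) = 0
    rw [ih J (by omega), zero_add]
    refine Finset.sum_eq_zero fun i _ => ?_
    split_ifs with hi
    · have := Finset.card_erase_of_mem hi.mem
      exact ih _ (by omega)
    · rfl

end Removal

/-- Reading the word from its first letter on removes all positions one after the other, and this
is the only way in which the full set of positions can become empty. -/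
theorem foldr_letterOp_univ {X : Type*} (G : SimpleGraph X) (l : List X) :
    l.foldr (fun c g => letterOp G l.get c g) (Pi.single ∅ 1) Finset.univ = 1 := by
  classical
  have key : ∀ m ≤ l.length, (l.drop m).foldr (fun c g => letterOp G l.get c g)
      (Pi.single ∅ 1) (Finset.univ.filter fun i : Fin l.length => m ≤ i) = 1 := by
    intro m hm
    induction hm using Nat.decreasingInduction with
    | self =>
      have : (Finset.univ.filter fun i : Fin l.length => l.length ≤ i) = ∅ := by
        ext i
        simp
      simp [this]
    | of_succ m hm ih =>
      have hm' : m < l.length := hm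
      rw [List.drop_eq_getElem_cons hm', List.foldr_cons, letterOp_apply, Pi.add_apply]
      have hrem : IsRemovable G l.get l[m] ⟨m, hm'⟩
          (Finset.univ.filter fun i : Fin l.length => m ≤ i) :=
        ⟨rfl, fun j _ => by simp [Fin.le_def]⟩
      have herase : (Finset.univ.filter fun i : Fin l.length => m ≤ i).erase ⟨m, hm'⟩ =
          Finset.univ.filter fun i : Fin l.length => m + 1 ≤ i := by
        ext i
        simp only [Finset.mem_erase, Finset.mem_filter, Finset.mem_univ, true_and, ne_eq,
          Fin.ext_iff]
        omega
      rw [removal_apply_of_isRemovable hrem, herase, ih, foldr_letterOp_apply_eq_zero, zero_add]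
      · intro J hJ
        rw [Pi.single_eq_of_ne (Finset.card_pos.1 hJ).ne_empty]
      · have h1 : ((Finset.univ.filter fun i : Fin l.length => m ≤ i)).card = l.length - m := by
          have : (Finset.univ.filter fun i : Fin l.length => m ≤ i) = Finset.Ici ⟨m, hm'⟩ := by
            ext i
            simp [Fin.le_def]
          rw [this, Fin.card_Ici]
        rw [h1, List.length_drop]
        omega
  simpa using key 0 (Nat.zero_le _)

/-! ### The graph of compatible sets -/

/-- Two distinct sets are adjacent if they are nested or disjoint. -/
def compatGraph (Y : Type*) : SimpleGraph (Set Y) where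
  Adj A B := A ≠ B ∧ (A ⊆ B ∨ B ⊆ A ∨ Disjoint A B)
  symm := ⟨fun _ _ h => ⟨h.1.symm, by
    rcases h.2 with h | h | h
    exacts [.inr (.inl h), .inl h, .inr (.inr h.symm)]⟩⟩
  loopless := ⟨fun _ h => h.1 rfl⟩

theorem compatGraph_adj_smul {H Y : Type*} [Group H] [MulAction H Y] (h : H) (A B : Set Y) :
    (compatGraph Y).Adj (h • A) (h • B) ↔ (compatGraph Y).Adj A B := by
  simp [compatGraph, Set.smul_set_subset_smul_set_iff, Set.disjoint_smul_set]

/-! ### The double cover of the circle -/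

section Cover

variable {n : ℕ}

/-- The covering map `ℤ/2nℤ → ℤ/nℤ`. -/
def coverMap (n : ℕ) : ZMod (2 * n) →+* ZMod n :=
  ZMod.castHom (Dvd.intro_left 2 rfl) (ZMod n)

theorem natCast_add_self : (n : ZMod (2 * n)) + n = 0 := by
  have := ZMod.natCast_self (2 * n)
  push_cast at this
  linear_combination this

/-- `d_x`: the interval `[i, j]_c` indexed by `x` has `d_x + 1` elements. -/
def arcLen (x : CactusIndex n) : ℕ := (x.1.2 - x.1.1).val

theorem arcLen_pos (x : CactusIndex n) : 0 < arcLen x := by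
  refine Nat.pos_of_ne_zero fun h => x.2 ?_
  exact (sub_eq_zero.1 ((ZMod.val_eq_zero _).1 h)).symm

/-- `[i, j]_c ⊂_c [k, l]_c` in terms of lengths: a lift of `[k, l]_c` contains a lift of
`[i, j]_c`. -/
def Nested (x y : CactusIndex n) : Prop := (x.1.1 - y.1.1).val + arcLen x ≤ arcLen y

theorem nested_refl (x : CactusIndex n) : Nested x x := by simp [Nested]

variable [NeZero n]

theorem val_coverMap (q : ZMod (2 * n)) : (coverMap n q).val = q.val % n := by
  conv_lhs => rw [← ZMod.natCast_zmod_val q, map_natCast, ZMod.val_natCast]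

theorem val_coverMap_of_lt {q : ZMod (2 * n)} (h : q.val < n) : (coverMap n q).val = q.val := by
  rw [val_coverMap, Nat.mod_eq_of_lt h]

theorem coverMap_natCast_val (p : ZMod n) : coverMap n (p.val : ZMod (2 * n)) = p := by
  rw [map_natCast, ZMod.natCast_zmod_val]

theorem val_natCast_val (p : ZMod n) : ((p.val : ℕ) : ZMod (2 * n)).val = p.val := by
  have := ZMod.val_lt p
  exact ZMod.val_natCast_of_lt (by omega)

theorem eq_or_eq_add_of_coverMap_eq {q r : ZMod (2 * n)} (h : coverMap n q = coverMap n r) :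
    q = r ∨ q = r + n := by
  have h0 : coverMap n (q - r) = 0 := by rw [map_sub, h, sub_self]
  have h1 : (q - r).val % n = 0 := by rw [← val_coverMap, h0, ZMod.val_zero]
  have h2 := ZMod.val_lt (q - r)
  obtain ⟨c, hc⟩ := Nat.dvd_of_mod_eq_zero h1
  have hc2 : c < 2 := by
    by_contra hcon
    have : n * 2 ≤ n * c := Nat.mul_le_mul_left n (by omega)
    omega
  have h3 : q - r = ((n * c : ℕ) : ZMod (2 * n)) := by rw [← hc, ZMod.natCast_zmod_val]
  interval_cases c
  · left
    simpa [sub_eq_zero] using h3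
  · right
    rw [mul_one] at h3
    linear_combination h3

theorem arcLen_lt (x : CactusIndex n) : arcLen x < n := ZMod.val_lt _

theorem natCast_arcLen (x : CactusIndex n) : (arcLen x : ZMod n) = x.1.2 - x.1.1 :=
  ZMod.natCast_zmod_val _

theorem val_sub_le_of_val_le {m : ℕ} [NeZero m] {d : ℕ} (hd : d < m) {r : ZMod m}
    (h : r.val ≤ d) : ((d : ZMod m) - r).val ≤ d := by
  have e : (d : ZMod m).val = d := ZMod.val_natCast_of_lt hd
  rw [ZMod.val_sub (by rwa [e]), e]
  exact Nat.sub_le _ _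

/-- A point of the cover lies above `[i, j]_c` if and only if it lies on one of the two arcs that
lift this interval. -/
theorem coverMap_mem_circInterval_iff (x : CactusIndex n) (q : ZMod (2 * n)) :
    coverMap n q ∈ circInterval n x.1.1 x.1.2 ↔
      ∃ u, coverMap n u = x.1.1 ∧ (q - u).val ≤ arcLen x := by
  constructor
  · intro h
    refine ⟨q - ((coverMap n q - x.1.1).val : ℕ), ?_, ?_⟩
    · rw [map_sub, coverMap_natCast_val, sub_sub_cancel]
    · rw [sub_sub_cancel, val_natCast_val]
      exact h
  · rintro ⟨u, hu, hq⟩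
    change (coverMap n q - x.1.1).val ≤ arcLen x
    have := arcLen_lt x
    rw [← hu, ← map_sub, val_coverMap_of_lt (by omega)]
    exact hq

/-- The sum of the end points of an arc that lifts `[i, j]_c`; it does not depend on the lift,
because `n + n = 0` in `ℤ/2nℤ`. -/
def endSum (x : CactusIndex n) : ZMod (2 * n) := 2 * (x.1.1.val : ℕ) + (arcLen x : ℕ)

theorem endSum_eq (x : CactusIndex n) {u : ZMod (2 * n)} (hu : coverMap n u = x.1.1) :
    endSum x = 2 * u + (arcLen x : ℕ) := by
  have h : coverMap n u = coverMap n (x.1.1.val : ZMod (2 * n)) := by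
    rw [hu, coverMap_natCast_val]
  rcases eq_or_eq_add_of_coverMap_eq h with rfl | rfl
  · rfl
  · rw [endSum]
    linear_combination -(natCast_add_self (n := n))

theorem coverMap_endSum (x : CactusIndex n) : coverMap n (endSum x) = x.1.1 + x.1.2 := by
  rw [endSum, map_add, map_mul, coverMap_natCast_val, map_natCast, natCast_arcLen, map_ofNat]
  ring

open Classical in
/-- The underlying map of the lift of `s_{i,j}` to the cover: it reverses both arcs above
`[i, j]_c`. Both reversals are given by the same formula. -/
noncomputable def coverReverseFun (x : CactusIndex n) (q : ZMod (2 * n)) : ZMod (2 * n) :=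
  if coverMap n q ∈ circInterval n x.1.1 x.1.2 then endSum x - q else q

theorem coverMap_endSum_sub_mem (x : CactusIndex n) (q : ZMod (2 * n)) :
    coverMap n (endSum x - q) ∈ circInterval n x.1.1 x.1.2 ↔
      coverMap n q ∈ circInterval n x.1.1 x.1.2 := by
  rw [map_sub, coverMap_endSum, circInterval_reflect]

theorem coverReverseFun_involutive (x : CactusIndex n) :
    Function.Involutive (coverReverseFun x) := by
  intro q
  by_cases h : coverMap n q ∈ circInterval n x.1.1 x.1.2
  · simp only [coverReverseFun, coverMap_endSum_sub_mem, h, if_true]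
    ring
  · simp only [coverReverseFun, h, if_false]

/-- The lift of `s_{i,j}` to a permutation of `ℤ/2nℤ`. -/
noncomputable def coverReverse (x : CactusIndex n) : Equiv.Perm (ZMod (2 * n)) :=
  (coverReverseFun_involutive x).toPerm

theorem coverReverse_of_mem {x : CactusIndex n} {q : ZMod (2 * n)}
    (h : coverMap n q ∈ circInterval n x.1.1 x.1.2) : coverReverse x q = endSum x - q :=
  if_pos h

theorem coverReverse_of_notMem {x : CactusIndex n} {q : ZMod (2 * n)}
    (h : coverMap n q ∉ circInterval n x.1.1 x.1.2) : coverReverse x q = q :=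
  if_neg h

theorem coverReverse_coverReverse (x : CactusIndex n) (q : ZMod (2 * n)) :
    coverReverse x (coverReverse x q) = q :=
  coverReverseFun_involutive x q

theorem coverReverse_mul_self (x : CactusIndex n) : coverReverse x * coverReverse x = 1 :=
  Equiv.ext (coverReverse_coverReverse x)

theorem coverReverse_inv (x : CactusIndex n) : (coverReverse x)⁻¹ = coverReverse x :=
  inv_eq_of_mul_eq_one_left (coverReverse_mul_self x)

theorem coverMap_coverReverse (x : CactusIndex n) (q : ZMod (2 * n)) :
    coverMap n (coverReverse x q) = circReverse n x.1.1 x.1.2 (coverMap n q) := by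
  by_cases h : coverMap n q ∈ circInterval n x.1.1 x.1.2
  · rw [coverReverse_of_mem h, map_sub, coverMap_endSum]
    exact (if_pos h).symm
  · rw [coverReverse_of_notMem h]
    exact (if_neg h).symm

/-! ### Nested intervals -/

theorem nested_of_circSubset {x y : CactusIndex n}
    (h : CircSubset n x.1.1 x.1.2 y.1.1 y.1.2) : Nested x y := by
  have hi : x.1.1 ∈ circInterval n x.1.1 x.1.2 := by simp [circInterval]
  have hj : x.1.2 ∈ circInterval n x.1.1 x.1.2 := by simp [circInterval]
  have h1 := h.2 _ hi _ hj (by rw [sub_self, ZMod.val_zero]; exact arcLen_pos x)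
  have h2 : (x.1.2 - y.1.1).val ≤ arcLen y := h.1 hj
  have e : x.1.2 - y.1.1 = (x.1.1 - y.1.1) + (x.1.2 - x.1.1) := by ring
  have hlt : arcLen x < n := arcLen_lt x
  rw [e] at h1 h2
  by_cases hw : (x.1.1 - y.1.1).val + arcLen x < n
  · rwa [ZMod.val_add_of_lt hw] at h2
  · have h3 := ZMod.val_add_val_of_le (a := x.1.1 - y.1.1) (b := x.1.2 - x.1.1) (not_lt.1 hw)
    change _ + arcLen x = _ at h3
    omega

theorem circSubset_of_nested {x y : CactusIndex n} (h : Nested x y) :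
    CircSubset n x.1.1 x.1.2 y.1.1 y.1.2 := by
  have hy := arcLen_lt y
  unfold Nested at h
  have key : ∀ p ∈ circInterval n x.1.1 x.1.2,
      (p - y.1.1).val = (p - x.1.1).val + (x.1.1 - y.1.1).val := by
    intro p (hp : (p - x.1.1).val ≤ arcLen x)
    rw [← ZMod.val_add_of_lt (by omega)]
    congr 1
    ring
  refine ⟨fun p hp => ?_, fun p hp q hq hpq => ?_⟩
  · have hp' : (p - x.1.1).val ≤ arcLen x := hp
    have := key p hp
    change (p - y.1.1).val ≤ arcLen y
    omega
  · rw [key p hp, key q hq]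
    omega

theorem Nested.mem {x y : CactusIndex n} (h : Nested x y) {q : ZMod n}
    (hq : q ∈ circInterval n x.1.1 x.1.2) : q ∈ circInterval n y.1.1 y.1.2 :=
  (circSubset_of_nested h).1 hq

theorem eq_of_nested {x y : CactusIndex n} (h : Nested x y) (h' : Nested y x) : x = y := by
  unfold Nested at h h'
  have h1 : x.1.1 = y.1.1 := sub_eq_zero.1 ((ZMod.val_eq_zero _).1 (by omega))
  have h2 : x.1.2 - x.1.1 = y.1.2 - y.1.1 := ZMod.val_injective n (by
    change arcLen x = arcLen y
    omega)
  refine Subtype.ext (Prod.ext h1 ?_)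
  rw [h1] at h2
  exact sub_left_injective h2

theorem cactusFlip_val {x y : CactusIndex n} (h : Nested x y) :
    (cactusFlip n x y).1 = (y.1.1 + y.1.2 - x.1.2, y.1.1 + y.1.2 - x.1.1) := by
  have hi : x.1.1 ∈ circInterval n x.1.1 x.1.2 := by simp [circInterval]
  have hj : x.1.2 ∈ circInterval n x.1.1 x.1.2 := by simp [circInterval]
  exact Prod.ext (if_pos (h.mem hj)) (if_pos (h.mem hi))

theorem arcLen_cactusFlip {x y : CactusIndex n} (h : Nested x y) :
    arcLen (cactusFlip n x y) = arcLen x := by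
  rw [arcLen, arcLen, cactusFlip_val h]
  congr 1
  ring

theorem nested_cactusFlip {x y : CactusIndex n} (h : Nested x y) :
    Nested (cactusFlip n x y) y := by
  have hy := arcLen_lt y
  unfold Nested at h ⊢
  rw [arcLen_cactusFlip h, cactusFlip_val h]
  have e : y.1.1 + y.1.2 - x.1.2 - y.1.1 =
      ((arcLen y - ((x.1.1 - y.1.1).val + arcLen x) : ℕ) : ZMod n) := by
    rw [Nat.cast_sub h, Nat.cast_add, natCast_arcLen, natCast_arcLen, ZMod.natCast_zmod_val]
    ring
  simp only [e]
  rw [ZMod.val_natCast_of_lt (by omega)]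
  omega

theorem cactusFlip_cactusFlip {x y : CactusIndex n} (h : Nested x y) :
    cactusFlip n (cactusFlip n x y) y = x := by
  apply Subtype.ext
  rw [cactusFlip_val (nested_cactusFlip h), cactusFlip_val h]
  ext <;> simp

theorem coverMap_sub_val {x y : CactusIndex n} {u : ZMod (2 * n)} (hu : coverMap n u = x.1.1) :
    coverMap n (u - ((x.1.1 - y.1.1).val : ℕ)) = y.1.1 := by
  rw [map_sub, coverMap_natCast_val, hu, sub_sub_cancel]

/-- The starting point of the mirror image of the arc that lifts `[i, j]_c` and starts at `u`. -/
theorem coverMap_flipStart {x y : CactusIndex n} (h : Nested x y) {u : ZMod (2 * n)}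
    (hu : coverMap n u = x.1.1) :
    coverMap n (u - 2 * ((x.1.1 - y.1.1).val : ℕ) + (arcLen y : ℕ) - (arcLen x : ℕ)) =
      (cactusFlip n x y).1.1 := by
  simp only [cactusFlip_val h, map_sub, map_add, map_mul, map_natCast, natCast_arcLen,
    ZMod.natCast_zmod_val, hu, map_ofNat]
  ring

theorem endSum_cactusFlip {x y : CactusIndex n} (h : Nested x y) :
    endSum (cactusFlip n x y) = 2 * endSum y - endSum x := by
  have hu := coverMap_natCast_val x.1.1
  set u : ZMod (2 * n) := (x.1.1.val : ZMod (2 * n))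
  have hu' := coverMap_sub_val (y := y) hu
  have hv := coverMap_flipStart h hu
  rw [endSum_eq _ hv, endSum_eq _ hu, endSum_eq _ hu', arcLen_cactusFlip h]
  ring

theorem coverReverse_mul_comm {x y : CactusIndex n}
    (h : circInterval n x.1.1 x.1.2 ∩ circInterval n y.1.1 y.1.2 = ∅) :
    coverReverse x * coverReverse y = coverReverse y * coverReverse x := by
  have hd : ∀ p, p ∈ circInterval n x.1.1 x.1.2 → p ∉ circInterval n y.1.1 y.1.2 :=
    fun p h1 h2 => Set.eq_empty_iff_forall_notMem.1 h p ⟨h1, h2⟩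
  ext1 q
  rw [Equiv.Perm.mul_apply, Equiv.Perm.mul_apply]
  by_cases h1 : coverMap n q ∈ circInterval n x.1.1 x.1.2
  · rw [coverReverse_of_notMem (hd _ h1), coverReverse_of_mem h1,
      coverReverse_of_notMem (hd _ ((coverMap_endSum_sub_mem x q).2 h1))]
  · rw [coverReverse_of_notMem h1]
    by_cases h2 : coverMap n q ∈ circInterval n y.1.1 y.1.2
    · rw [coverReverse_of_mem h2,
        coverReverse_of_notMem fun h3 => hd _ h3 ((coverMap_endSum_sub_mem y q).2 h2)]
    · rw [coverReverse_of_notMem h2, coverReverse_of_notMem h1]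

theorem coverReverse_mul_of_nested {x y : CactusIndex n} (h : Nested x y) :
    coverReverse x * coverReverse y = coverReverse y * coverReverse (cactusFlip n x y) := by
  have hz : ∀ q, coverMap n q ∈ circInterval n (cactusFlip n x y).1.1 (cactusFlip n x y).1.2 ↔
      coverMap n (endSum y - q) ∈ circInterval n x.1.1 x.1.2 := by
    intro q
    rw [← coverMap_endSum_sub_mem x (endSum y - q)]
    simp only [cactusFlip_val h, map_sub, coverMap_endSum, circInterval, Set.mem_ofPred_eq]
    ring_nf
  ext1 q
  rw [Equiv.Perm.mul_apply, Equiv.Perm.mul_apply]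
  by_cases h2 : coverMap n q ∈ circInterval n y.1.1 y.1.2
  · rw [coverReverse_of_mem h2]
    by_cases h1 : coverMap n (endSum y - q) ∈ circInterval n x.1.1 x.1.2
    · have h3 : coverMap n (endSum (cactusFlip n x y) - q) ∈ circInterval n y.1.1 y.1.2 :=
        (nested_cactusFlip h).mem ((coverMap_endSum_sub_mem _ q).2 ((hz q).2 h1))
      rw [coverReverse_of_mem h1, coverReverse_of_mem ((hz q).2 h1), coverReverse_of_mem h3,
        endSum_cactusFlip h]
      ring
    · rw [coverReverse_of_notMem h1, coverReverse_of_notMem (mt (hz q).1 h1),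
        coverReverse_of_mem h2]
  · have h3 : coverMap n (endSum y - q) ∉ circInterval n x.1.1 x.1.2 := fun h3 =>
      h2 ((coverMap_endSum_sub_mem y q).1 (h.mem h3))
    rw [coverReverse_of_notMem h2, coverReverse_of_notMem (mt (hz q).1 h3),
      coverReverse_of_notMem h2, coverReverse_of_notMem fun h4 => h2 (h.mem h4)]

/-! ### Blocks -/

/-- The pair of arcs above `[i, j]_c`, encoded by the relation of lying on a common arc. With this
encoding the unordered pair of arcs becomes a set on which permutations of the cover act, and
inclusion and disjointness of relations are those of arcs. -/
def coverBlock (x : CactusIndex n) : Set (ZMod (2 * n) × ZMod (2 * n)) :=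
  {q | ∃ u, coverMap n u = x.1.1 ∧ (q.1 - u).val ≤ arcLen x ∧ (q.2 - u).val ≤ arcLen x}

theorem mem_circInterval_of_mem_coverBlock {x : CactusIndex n} {q : ZMod (2 * n) × ZMod (2 * n)}
    (h : q ∈ coverBlock x) : coverMap n q.1 ∈ circInterval n x.1.1 x.1.2 ∧
      coverMap n q.2 ∈ circInterval n x.1.1 x.1.2 := by
  obtain ⟨u, hu, h1, h2⟩ := h
  exact ⟨(coverMap_mem_circInterval_iff x _).2 ⟨u, hu, h1⟩,
    (coverMap_mem_circInterval_iff x _).2 ⟨u, hu, h2⟩⟩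

theorem coverBlock_subset_iff {x y : CactusIndex n} :
    coverBlock x ⊆ coverBlock y ↔ Nested x y := by
  have hx := arcLen_lt x
  have hy := arcLen_lt y
  constructor
  · intro h
    have hu := coverMap_natCast_val x.1.1
    set u : ZMod (2 * n) := (x.1.1.val : ZMod (2 * n))
    have hval : ((arcLen x : ℕ) : ZMod (2 * n)).val = arcLen x :=
      ZMod.val_natCast_of_lt (by omega)
    have hmem : (u, u + (arcLen x : ℕ)) ∈ coverBlock x := ⟨u, hu, by simp, by simp [hval]⟩
    obtain ⟨v, hv, h1, h2⟩ := h hmem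
    simp only at h1 h2
    have h3 : (x.1.1 - y.1.1).val = (u - v).val := by
      rw [← hu, ← hv, ← map_sub, val_coverMap_of_lt (by omega)]
    have e : u + (arcLen x : ℕ) - v = (u - v) + (arcLen x : ℕ) := by ring
    rw [e, ZMod.val_add_of_lt (by rw [hval]; omega), hval] at h2
    rwa [Nested, h3]
  · intro h
    unfold Nested at h
    rintro ⟨p, q⟩ ⟨u, hu, h1, h2⟩
    have key : ∀ p : ZMod (2 * n), (p - u).val ≤ arcLen x →
        (p - (u - ((x.1.1 - y.1.1).val : ℕ))).val ≤ arcLen y := by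
      intro p hp
      have e : p - (u - ((x.1.1 - y.1.1).val : ℕ)) = (p - u) + ((x.1.1 - y.1.1).val : ℕ) := by
        ring
      rw [e]
      refine (ZMod.val_add_le _ _).trans ?_
      rw [val_natCast_val]
      omega
    exact ⟨_, coverMap_sub_val hu, key p h1, key q h2⟩

theorem disjoint_coverBlock_iff {x y : CactusIndex n} :
    Disjoint (coverBlock x) (coverBlock y) ↔
      circInterval n x.1.1 x.1.2 ∩ circInterval n y.1.1 y.1.2 = ∅ := by
  rw [Set.disjoint_left, Set.eq_empty_iff_forall_notMem]
  constructor
  · rintro h p ⟨h1, h2⟩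
    rw [← coverMap_natCast_val p] at h1 h2
    obtain ⟨u, hu, hu'⟩ := (coverMap_mem_circInterval_iff x _).1 h1
    obtain ⟨v, hv, hv'⟩ := (coverMap_mem_circInterval_iff y _).1 h2
    exact h (a := ((p.val : ℕ), (p.val : ℕ))) ⟨u, hu, hu', hu'⟩ ⟨v, hv, hv', hv'⟩
  · intro h q h1 h2
    exact h _ ⟨(mem_circInterval_of_mem_coverBlock h1).1, (mem_circInterval_of_mem_coverBlock h2).1⟩

theorem coverBlock_injective : Function.Injective (coverBlock (n := n)) := fun _ _ h =>
  eq_of_nested (coverBlock_subset_iff.1 h.subset) (coverBlock_subset_iff.1 h.symm.subset)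

theorem compatGraph_adj_coverBlock {x y : CactusIndex n} :
    (compatGraph _).Adj (coverBlock x) (coverBlock y) ↔ x ≠ y ∧ (Nested x y ∨ Nested y x ∨
      circInterval n x.1.1 x.1.2 ∩ circInterval n y.1.1 y.1.2 = ∅) := by
  rw [← disjoint_coverBlock_iff, ← coverBlock_subset_iff, ← coverBlock_subset_iff,
    ← coverBlock_injective.ne_iff]
  rfl

/-- To compute the image of a set under an involution, inclusions both ways suffice. -/
theorem coverReverse_smul_eq {y : CactusIndex n} {A B : Set (ZMod (2 * n) × ZMod (2 * n))}
    (hAB : ∀ q ∈ A, (coverReverse y q.1, coverReverse y q.2) ∈ B)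
    (hBA : ∀ q ∈ B, (coverReverse y q.1, coverReverse y q.2) ∈ A) :
    coverReverse y • A = B := by
  ext q
  rw [Set.mem_smul_set_iff_inv_smul_mem, coverReverse_inv]
  refine ⟨fun h => ?_, hBA q⟩
  have := hAB _ h
  simpa only [Prod.smul_fst, Prod.smul_snd, Equiv.Perm.smul_def, coverReverse_coverReverse]
    using this

theorem coverReverse_smul_of_disjoint {x y : CactusIndex n}
    (h : circInterval n x.1.1 x.1.2 ∩ circInterval n y.1.1 y.1.2 = ∅) :
    coverReverse x • coverBlock y = coverBlock y := by
  have hd : ∀ p, p ∈ circInterval n y.1.1 y.1.2 → p ∉ circInterval n x.1.1 x.1.2 :=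
    fun p h1 h2 => Set.eq_empty_iff_forall_notMem.1 h p ⟨h2, h1⟩
  have key : ∀ q ∈ coverBlock y, (coverReverse x q.1, coverReverse x q.2) ∈ coverBlock y := by
    intro q hq
    have hm := mem_circInterval_of_mem_coverBlock hq
    rwa [coverReverse_of_notMem (hd _ hm.1), coverReverse_of_notMem (hd _ hm.2)]
  exact coverReverse_smul_eq key key

theorem coverReverse_smul_of_nested {x y : CactusIndex n} (h : Nested x y) :
    coverReverse y • coverBlock x = coverBlock (cactusFlip n x y) := by
  have key : ∀ x : CactusIndex n, Nested x y → ∀ q ∈ coverBlock x,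
      (coverReverse y q.1, coverReverse y q.2) ∈ coverBlock (cactusFlip n x y) := by
    intro x h q hq
    have hx := arcLen_lt x
    have hm := mem_circInterval_of_mem_coverBlock hq
    obtain ⟨u, hu, h1, h2⟩ := hq
    rw [coverReverse_of_mem (h.mem hm.1), coverReverse_of_mem (h.mem hm.2),
      endSum_eq y (coverMap_sub_val hu)]
    refine ⟨u - 2 * ((x.1.1 - y.1.1).val : ℕ) + (arcLen y : ℕ) - (arcLen x : ℕ), ?_, ?_, ?_⟩
    · exact coverMap_flipStart h hu
    · rw [arcLen_cactusFlip h]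
      convert val_sub_le_of_val_le (by omega : arcLen x < 2 * n) h1 using 2
      ring
    · rw [arcLen_cactusFlip h]
      convert val_sub_le_of_val_le (by omega : arcLen x < 2 * n) h2 using 2
      ring
  refine coverReverse_smul_eq (key x h) ?_
  have := key _ (nested_cactusFlip h)
  rwa [cactusFlip_cactusFlip h] at this

theorem coverReverse_smul_self (x : CactusIndex n) :
    coverReverse x • coverBlock x = coverBlock x := by
  rw [coverReverse_smul_of_nested (nested_refl x)]
  congr 1
  apply Subtype.ext
  rw [cactusFlip_val (nested_refl x)]
  ext <;> simp

theorem coverReverse_smul_outer {x y : CactusIndex n} (h : Nested x y) :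
    coverReverse x • coverBlock y = coverBlock y := by
  have hy := arcLen_lt y
  have hxy : (x.1.1 - y.1.1).val + arcLen x ≤ arcLen y := h
  have arc : ∀ v q : ZMod (2 * n), coverMap n v = y.1.1 → (q - v).val ≤ arcLen y →
      (coverReverse x q - v).val ≤ arcLen y := by
    intro v q hv hq
    by_cases hm : coverMap n q ∈ circInterval n x.1.1 x.1.2
    · rw [coverReverse_of_mem hm]
      obtain ⟨u, hu, hqu⟩ := (coverMap_mem_circInterval_iff x q).1 hm
      have hr := val_natCast_val (x.1.1 - y.1.1)
      have hc : coverMap n u = coverMap n (v + ((x.1.1 - y.1.1).val : ℕ)) := by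
        rw [map_add, coverMap_natCast_val, hu, hv, add_sub_cancel]
      rw [endSum_eq x hu]
      rcases eq_or_eq_add_of_coverMap_eq hc with hc | hc
      · have e : 2 * u + (arcLen x : ℕ) - q - v =
            ((arcLen x : ℕ) - (q - u)) + ((x.1.1 - y.1.1).val : ℕ) := by
          rw [hc]
          ring
        rw [e]
        refine (ZMod.val_add_le _ _).trans ?_
        have := val_sub_le_of_val_le (by omega : arcLen x < 2 * n) hqu
        omega
      -- The other lift of `[i, j]_c` does not meet the arc that starts at `v`.
      · exfalso
        have hn : ((n : ℕ) : ZMod (2 * n)).val = n := ZMod.val_natCast_of_lt (by omega)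
        have e : q - v = (q - u) + ((x.1.1 - y.1.1).val : ℕ) + (n : ℕ) := by
          rw [hc]
          ring
        have h1 : ((q - u) + ((x.1.1 - y.1.1).val : ℕ)).val =
            (q - u).val + (x.1.1 - y.1.1).val := by
          rw [ZMod.val_add_of_lt (by omega), hr]
        rw [e, ZMod.val_add_of_lt (by omega), hn] at hq
        omega
    · rwa [coverReverse_of_notMem hm]
  have key : ∀ q ∈ coverBlock y, (coverReverse x q.1, coverReverse x q.2) ∈ coverBlock y := by
    rintro q ⟨v, hv, h1, h2⟩
    exact ⟨v, hv, arc v _ hv h1, arc v _ hv h2⟩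
  exact coverReverse_smul_eq key key

end Cover

/-! ### Words in the affine cactus group -/

section Words

variable {n : ℕ} [NeZero n]

/-- The generator `σ_x`. -/
def sigma (x : CactusIndex n) : AffineCactusGroup n := PresentedGroup.of x

theorem sigma_mul_self (x : CactusIndex n) : sigma x * sigma x = 1 := by
  have := PresentedGroup.one_of_mem (rels := {r | AffineCactusRel n r}) (AffineCactusRel.square x)
  rwa [map_pow, pow_two] at this

theorem sigma_inv (x : CactusIndex n) : (sigma x)⁻¹ = sigma x :=
  inv_eq_of_mul_eq_one_left (sigma_mul_self x)

theorem sigma_comm {x y : CactusIndex n}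
    (h : circInterval n x.1.1 x.1.2 ∩ circInterval n y.1.1 y.1.2 = ∅) :
    sigma x * sigma y = sigma y * sigma x := by
  have := PresentedGroup.one_of_mem (rels := {r | AffineCactusRel n r})
    (AffineCactusRel.disjoint x y h)
  rw [map_mul, map_inv, mul_inv_eq_one] at this
  simp only [map_mul] at this
  exact this

theorem sigma_mul_of_nested {x y : CactusIndex n} (h : Nested x y) :
    sigma x * sigma y = sigma y * sigma (cactusFlip n x y) := by
  have := PresentedGroup.one_of_mem (rels := {r | AffineCactusRel n r})
    (AffineCactusRel.nested x y (circSubset_of_nested h))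
  rw [map_mul, map_inv, mul_inv_eq_one] at this
  simp only [map_mul] at this
  exact this

/-- The element of the affine cactus group represented by a word. -/
def wordProd (l : List (CactusIndex n)) : AffineCactusGroup n := (l.map sigma).prod

/-- The permutation of the double cover represented by a word. -/
noncomputable def coverPerm (l : List (CactusIndex n)) : Equiv.Perm (ZMod (2 * n)) :=
  (l.map coverReverse).prod

/-- The blocks spelled by a word `x₁ ⋯ x_k`: the letter `x_m` contributes the block of `x_m`, moved
back by the permutation of the letters to its right. -/
noncomputable def blockWord :
    List (CactusIndex n) → List (Set (ZMod (2 * n) × ZMod (2 * n)))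
  | [] => []
  | x :: l => (coverPerm l)⁻¹ • coverBlock x :: blockWord l

@[simp] theorem length_blockWord (l : List (CactusIndex n)) : (blockWord l).length = l.length := by
  induction l with
  | nil => rfl
  | cons x l ih => simp [blockWord, ih]

theorem wordProd_cons (x : CactusIndex n) (l : List (CactusIndex n)) :
    wordProd (x :: l) = sigma x * wordProd l := by
  simp [wordProd]

theorem coverPerm_cons (x : CactusIndex n) (l : List (CactusIndex n)) :
    coverPerm (x :: l) = coverReverse x * coverPerm l := by
  simp [coverPerm]

theorem exists_wordProd_eq (g : AffineCactusGroup n) : ∃ l, wordProd l = g := by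
  induction g using PresentedGroup.induction_on with
  | H w =>
    induction w using FreeGroup.induction_on with
    | C1 => exact ⟨[], (map_one _).symm⟩
    | of x => exact ⟨[x], by rw [wordProd_cons]; exact mul_one _⟩
    | inv_of x _ =>
      refine ⟨[x], ?_⟩
      rw [map_inv, wordProd_cons]
      exact (mul_one _).trans (sigma_inv x).symm
    | mul v w hv hw =>
      obtain ⟨l, hl⟩ := hv
      obtain ⟨l', hl'⟩ := hw
      refine ⟨l ++ l', ?_⟩
      rw [map_mul, ← hl, ← hl']
      simp [wordProd]

/-- If the blocks of two neighbouring letters commute, a defining relation exchanges the letters;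
the letter that moves to the right keeps its block. -/
theorem exists_sigma_mul_sigma_eq {x y : CactusIndex n}
    (h : (compatGraph _).Adj (coverBlock x) (coverBlock y)) :
    ∃ y' x', sigma x * sigma y = sigma y' * sigma x' ∧
      coverBlock x' = coverReverse y • coverBlock x := by
  obtain ⟨-, h | h | h⟩ := compatGraph_adj_coverBlock.1 h
  · exact ⟨y, cactusFlip n x y, sigma_mul_of_nested h, (coverReverse_smul_of_nested h).symm⟩
  · refine ⟨cactusFlip n y x, x, ?_, (coverReverse_smul_outer h).symm⟩
    have e := sigma_mul_of_nested h
    have e1 : sigma (cactusFlip n y x) = sigma x * sigma y * sigma x := by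
      rw [mul_assoc, e, ← mul_assoc, sigma_mul_self, one_mul]
    rw [e1, mul_assoc, sigma_mul_self, mul_one]
  · refine ⟨y, x, sigma_comm h, (coverReverse_smul_of_disjoint ?_).symm⟩
    rwa [Set.inter_comm]

/-- A letter that commutes past all letters before the next occurrence of its block can be moved
there, where it cancels. -/
theorem exists_shorter_word (l : List (CactusIndex n)) (x : CactusIndex n) (j : ℕ)
    (hj : j < (blockWord l).length) (hx : (blockWord l)[j] = (coverPerm l)⁻¹ • coverBlock x)
    (hadj : ∀ (m : ℕ) (hm : m < j), (compatGraph _).Adj ((blockWord l)[m]) ((blockWord l)[j])) :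
    ∃ l', wordProd l' = sigma x * wordProd l ∧ l'.length < l.length := by
  induction l generalizing x j with
  | nil => simp [blockWord] at hj
  | cons z l ih =>
    have hinv : (coverPerm (z :: l))⁻¹ • coverBlock x =
        (coverPerm l)⁻¹ • (coverReverse z • coverBlock x) := by
      rw [coverPerm_cons, mul_inv_rev, mul_smul, coverReverse_inv]
    rw [hinv] at hx
    cases j with
    | zero =>
      have h1 : coverBlock z = coverReverse z • coverBlock x := smul_left_cancel _ hx
      rw [← coverReverse_smul_self z] at h1
      have h2 := coverBlock_injective (smul_left_cancel _ h1)
      refine ⟨l, ?_, by simp⟩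
      rw [h2, wordProd_cons, ← mul_assoc, sigma_mul_self, one_mul]
    | succ j =>
      have h0 := hadj 0 (Nat.succ_pos j)
      rw [hx] at h0
      change (compatGraph _).Adj ((coverPerm l)⁻¹ • coverBlock z) _ at h0
      rw [compatGraph_adj_smul, ← coverReverse_smul_self z, compatGraph_adj_smul] at h0
      obtain ⟨z', x', he, hx'⟩ := exists_sigma_mul_sigma_eq h0.symm
      obtain ⟨l', hl', hlen⟩ := ih x' j (by simpa [blockWord] using hj) (by rw [hx']; exact hx)
        (fun m hm => hadj (m + 1) (by omega))
      refine ⟨z' :: l', ?_, by simpa using hlen⟩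
      rw [wordProd_cons, wordProd_cons, hl', ← mul_assoc, ← mul_assoc, he]

theorem isReducedWord_blockWord (l : List (CactusIndex n))
    (hmin : ∀ l', wordProd l' = wordProd l → l.length ≤ l'.length) :
    IsReducedWord (compatGraph _) (blockWord l).get := by
  have key : ∀ (i j : ℕ) (hj : j < (blockWord l).length) (hij : i < j),
      (blockWord l)[i] = (blockWord l)[j] → ∃ (m : ℕ) (_ : i < m) (hm : m < j),
        ¬ (compatGraph _).Adj ((blockWord l)[m]) ((blockWord l)[i]) := by
    induction l with
    | nil =>
      intro i j hj
      simp [blockWord] at hj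
    | cons x l ih =>
      intro i j hj hij heq
      obtain ⟨j, rfl⟩ : ∃ j', j = j' + 1 := ⟨j - 1, by omega⟩
      cases i with
      | zero =>
        by_contra hcon
        push Not at hcon
        have heq' : (blockWord l)[j]'(by simpa [blockWord] using hj) =
            (coverPerm l)⁻¹ • coverBlock x := heq.symm
        obtain ⟨l', hl', hlen⟩ := exists_shorter_word l x j (by simpa [blockWord] using hj) heq'
          (fun m hm => by
            rw [heq']
            exact hcon (m + 1) (by omega) (by omega))
        have := hmin l' (by rw [hl', wordProd_cons])
        simp only [List.length_cons] at this
        omega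
      | succ i =>
        obtain ⟨m, h1, h2, h3⟩ := ih (fun l' hl' => by
            have := hmin (x :: l') (by rw [wordProd_cons, wordProd_cons, hl'])
            simpa using this) i j (by simpa [blockWord] using hj) (by omega) heq
        exact ⟨m + 1, by omega, by omega, h3⟩
  intro i j hij heq
  obtain ⟨m, h1, h2, h3⟩ := key i j j.2 hij heq
  exact ⟨⟨m, by omega⟩, h1, h2, h3⟩

end Words

/-! ### The finite action attached to a reduced word -/

section Action

variable {n : ℕ} [NeZero n] {k : ℕ} (a : Fin k → Set (ZMod (2 * n) × ZMod (2 * n)))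

/-- The finite set on which the affine cactus group acts: a permutation of the double cover
together with an `𝔽₂`-valued function of sets of positions. -/
abbrev ActionSpace (n k : ℕ) : Type :=
  Equiv.Perm (ZMod (2 * n)) × (Finset (Fin k) → ZMod 2)

/-- The action of a generator. It is the action of the semidirect product of the right-angled
Coxeter group of blocks and the permutation group, induced from the removal operators. -/
noncomputable def generatorFun (x : CactusIndex n) (p : ActionSpace n k) : ActionSpace n k :=
  (coverReverse x * p.1, letterOp (compatGraph _) a (p.1⁻¹ • coverBlock x) p.2)

variable {a}

theorem generatorFun_comp (x y : CactusIndex n) (p : ActionSpace n k) :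
    generatorFun a x (generatorFun a y p) = (coverReverse x * coverReverse y * p.1,
      letterOp (compatGraph _) a (p.1⁻¹ • (coverReverse y • coverBlock x))
        (letterOp (compatGraph _) a (p.1⁻¹ • coverBlock y) p.2)) := by
  simp only [generatorFun, mul_inv_rev, mul_smul, coverReverse_inv, mul_assoc]

theorem generatorFun_involutive (ha : IsReducedWord (compatGraph _) a) (x : CactusIndex n) :
    Function.Involutive (generatorFun a x) := by
  intro p
  rw [generatorFun_comp, coverReverse_smul_self, letterOp_letterOp ha, coverReverse_mul_self,
    one_mul]

/-- The permutation of the action space by which a generator acts. -/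
noncomputable def generatorPerm (ha : IsReducedWord (compatGraph _) a) (x : CactusIndex n) :
    Equiv.Perm (ActionSpace n k) :=
  (generatorFun_involutive ha x).toPerm

theorem generatorPerm_rel (ha : IsReducedWord (compatGraph _) a) (r : FreeGroup (CactusIndex n))
    (hr : r ∈ {r : FreeGroup (CactusIndex n) | AffineCactusRel n r}) :
    FreeGroup.lift (generatorPerm ha) r = 1 := by
  cases hr with
  | square x =>
    rw [map_pow, FreeGroup.lift_apply_of, pow_two]
    exact Equiv.ext (generatorFun_involutive ha x)
  | disjoint x y h =>
    rw [map_mul, map_inv, mul_inv_eq_one]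
    simp only [map_mul, FreeGroup.lift_apply_of]
    refine Equiv.ext fun p => ?_
    change generatorFun a x (generatorFun a y p) = generatorFun a y (generatorFun a x p)
    have h' := h
    rw [Set.inter_comm] at h'
    rw [generatorFun_comp, generatorFun_comp, coverReverse_smul_of_disjoint h,
      coverReverse_smul_of_disjoint h', coverReverse_mul_comm h]
    have hne : x ≠ y := by
      rintro rfl
      have hx : x.1.1 ∈ circInterval n x.1.1 x.1.2 := by simp [circInterval]
      rw [Set.inter_self] at h
      exact Set.eq_empty_iff_forall_notMem.1 h _ hx
    rw [letterOp_comm]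
    rw [compatGraph_adj_smul, compatGraph_adj_coverBlock]
    exact ⟨hne, .inr (.inr h)⟩
  | nested x y h =>
    replace h := nested_of_circSubset h
    rw [map_mul, map_inv, mul_inv_eq_one]
    simp only [map_mul, FreeGroup.lift_apply_of]
    refine Equiv.ext fun p => ?_
    change generatorFun a x (generatorFun a y p) =
      generatorFun a y (generatorFun a (cactusFlip n x y) p)
    have hz := nested_cactusFlip h
    rw [generatorFun_comp, generatorFun_comp, coverReverse_smul_of_nested h,
      coverReverse_smul_outer hz, coverReverse_mul_of_nested h]
    by_cases hne : cactusFlip n x y = y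
    · rw [hne]
    · rw [letterOp_comm]
      rw [compatGraph_adj_smul, compatGraph_adj_coverBlock]
      exact ⟨hne, .inl hz⟩

/-- The action of the affine cactus group on the action space of a reduced word. -/
noncomputable def blockAction (ha : IsReducedWord (compatGraph _) a) :
    AffineCactusGroup n →* Equiv.Perm (ActionSpace n k) :=
  PresentedGroup.toGroup (f := generatorPerm ha) (generatorPerm_rel ha)

theorem blockAction_sigma_mul (ha : IsReducedWord (compatGraph _) a) (x : CactusIndex n)
    (g : AffineCactusGroup n) (p : ActionSpace n k) :
    blockAction ha (sigma x * g) p = generatorFun a x (blockAction ha g p) := by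
  rw [map_mul, Equiv.Perm.mul_apply]
  exact congrFun (congrArg DFunLike.coe (PresentedGroup.toGroup.of (generatorPerm_rel ha))) _

theorem blockAction_wordProd (ha : IsReducedWord (compatGraph _) a) (l : List (CactusIndex n))
    (f : Finset (Fin k) → ZMod 2) : blockAction ha (wordProd l) (1, f) =
      (coverPerm l, (blockWord l).foldr (fun c g => letterOp (compatGraph _) a c g) f) := by
  induction l with
  | nil => rw [wordProd, List.map_nil, List.prod_nil, map_one]; rfl
  | cons x l ih =>
    rw [wordProd_cons, blockAction_sigma_mul, ih, coverPerm_cons]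
    rfl

theorem exists_raisesBy_blockAction (ha : IsReducedWord (compatGraph _) a)
    (l : List (CactusIndex n)) (h : Equiv.Perm (ZMod (2 * n))) :
    ∃ T : Module.End (ZMod 2) (Finset (Fin k) → ZMod 2), RaisesBy 1 T ∧
      ∀ f, blockAction ha (wordProd l) (h, f) = (coverPerm l * h, T f) := by
  induction l with
  | nil =>
    refine ⟨1, raisesBy_one 1, fun f => ?_⟩
    rw [wordProd, List.map_nil, List.prod_nil, map_one]
    rfl
  | cons x l ih =>
    obtain ⟨T, hT, hTf⟩ := ih
    refine ⟨letterOp (compatGraph _) a ((coverPerm l * h)⁻¹ • coverBlock x) * T,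
      (raisesBy_letterOp _).mul hT, fun f => ?_⟩
    rw [wordProd_cons, blockAction_sigma_mul, hTf, coverPerm_cons, mul_assoc]
    rfl

theorem coverMap_coverPerm (l : List (CactusIndex n)) (q : ZMod (2 * n)) :
    coverMap n (coverPerm l q) = affineCactusToPerm n (wordProd l) (coverMap n q) := by
  induction l with
  | nil => simp [coverPerm, wordProd]
  | cons x l ih =>
    rw [coverPerm_cons, wordProd_cons, map_mul, Equiv.Perm.mul_apply, Equiv.Perm.mul_apply,
      coverMap_coverReverse, ih]
    exact (congrFun (congrArg DFunLike.coe (PresentedGroup.toGroup.of (circReverse_rel n))) _).symm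

/-- A permutation of the double cover that preserves all fibres, which have two elements each, is
an involution. -/
theorem mul_self_eq_one_of_coverMap {h : Equiv.Perm (ZMod (2 * n))}
    (hh : ∀ q, coverMap n (h q) = coverMap n q) : h * h = 1 := by
  ext1 q
  rw [Equiv.Perm.mul_apply, Equiv.Perm.one_apply]
  rcases eq_or_eq_add_of_coverMap_eq (hh q) with h1 | h1
  · rw [h1, h1]
  · rcases eq_or_eq_add_of_coverMap_eq (hh (h q)) with h2 | h2
    · rw [h2]
      exact h.injective h2
    · rw [h2, h1, add_assoc, natCast_add_self, add_zero]

/-- The pure affine cactus group acts through a `2`-group: the square of a pure element fixes the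
permutation component and is unipotent on the other one. -/
theorem blockAction_pow_eq_one (ha : IsReducedWord (compatGraph _) a) {g : AffineCactusGroup n}
    (hg : g ∈ pureAffineCactusGroup n) : blockAction ha g ^ 2 ^ (k + 2) = 1 := by
  obtain ⟨l, rfl⟩ := exists_wordProd_eq g
  have hl : coverPerm l * coverPerm l = 1 := mul_self_eq_one_of_coverMap fun q => by
    rw [coverMap_coverPerm, MonoidHom.mem_ker.1 hg, Equiv.Perm.one_apply]
  have hl1 : coverPerm (l ++ l) = 1 := by
    rw [← hl]
    simp [coverPerm]
  have hl2 : blockAction ha (wordProd l) ^ 2 = blockAction ha (wordProd (l ++ l)) := by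
    rw [pow_two, ← map_mul]
    simp [wordProd]
  rw [show 2 ^ (k + 2) = 2 * 2 ^ (k + 1) by ring, pow_mul, hl2]
  refine Equiv.ext fun ⟨h, f⟩ => ?_
  obtain ⟨T, hT, hTf⟩ := exists_raisesBy_blockAction ha (l ++ l) h
  rw [hl1, one_mul] at hTf
  have key : ∀ m : ℕ, (blockAction ha (wordProd (l ++ l)) ^ m) (h, f) = (h, (T ^ m) f) := by
    intro m
    induction m with
    | zero => rfl
    | succ m ih => rw [pow_succ', Equiv.Perm.mul_apply, ih, hTf, pow_succ', Module.End.mul_apply]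
  rw [key, hT.pow_eq_one]
  rfl

end Action

theorem mainTheorem3 (n : ℕ) [NeZero n] (hn : 2 < n) :
    IsResiduallyNilpotent (pureAffineCactusGroup n) := by
  classical
  rintro ⟨g, hg⟩ hne
  -- A word of minimal length representing `g`.
  obtain ⟨l, hl, hmin⟩ : ∃ l, wordProd l = g ∧ ∀ l', wordProd l' = g → l.length ≤ l'.length := by
    obtain ⟨l, hl, hmin⟩ := WellFounded.has_min (measure List.length).wf
      {l : List (CactusIndex n) | wordProd l = g} (exists_wordProd_eq g)
    exact ⟨l, hl, fun l' hl' => not_lt.1 (hmin l' hl')⟩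
  have ha := isReducedWord_blockWord l (by rwa [hl])
  let ρ := (blockAction ha).comp (pureAffineCactusGroup n).subtype
  refine ⟨ρ.ker, inferInstance, fun hker => ?_, ?_⟩
  · have h1 : blockAction ha (wordProd l) = 1 := by
      rw [hl]
      exact hker
    have h2 := blockAction_wordProd ha l (Pi.single ∅ 1)
    rw [h1, Equiv.Perm.one_apply, Prod.mk.injEq] at h2
    have h3 := congrFun h2.2 Finset.univ
    rw [foldr_letterOp_univ] at h3
    -- The word is nonempty, so that the full set of positions is not the empty set.
    have hlen : 0 < l.length := by
      refine List.length_pos_iff.2 fun h => hne (Subtype.ext ?_)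
      change g = 1
      rw [← hl, h]
      rfl
    have h4 : (Finset.univ : Finset (Fin (blockWord l).length)) ≠ ∅ := by
      rw [← Finset.card_pos.trans Finset.nonempty_iff_ne_empty, Finset.card_univ,
        Fintype.card_fin, length_blockWord]
      exact hlen
    rw [Pi.single_eq_of_ne h4] at h3
    exact zero_ne_one h3
  · have : Finite (pureAffineCactusGroup n ⧸ ρ.ker) :=
      Finite.of_injective _ (QuotientGroup.kerLift_injective ρ)
    have : Fact (Nat.Prime 2) := ⟨Nat.prime_two⟩
    refine IsPGroup.isNilpotent (p := 2) fun q => ?_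
    obtain ⟨x, rfl⟩ := QuotientGroup.mk_surjective q
    refine ⟨(blockWord l).length + 2, ?_⟩
    rw [← QuotientGroup.mk_pow, QuotientGroup.eq_one_iff, MonoidHom.mem_ker, map_pow]
    exact blockAction_pow_eq_one ha x.2
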